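/- Work in the Euclidean plane. A polygonal region is a bounded closed set whose boundary is the union of finitely many line segments with pairwise disjoint interiors (it need be neither connected nor convex, and degenerate regions such as segments or points are allowed); its vertices are the endpoints of these segments. Let $D_t(x)$ be the closed disk of radius $t$ around $x$, let $\mathrm{offset}(X,t)=X\oplus D_t(0)$ be the Minkowski sum, and let $\mathrm{inset}(X,t)=\{x : D_t(x)\subseteq X\}$. Two sets are $\varepsilon$-close if their Hausdorff distance is at most $\varepsilon$. Let $0<\varepsilon<r$, let $Q$ be a convex polygonal region with vertices $q_1,\dots,q_n$, and put $\Pi=\mathrm{inset}(\mathrm{offset}(Q,\varepsilon),r)$. Assume that $\Pi$ has nonempty interior, and that there is a polygonal region whose $r$-offset is $\varepsilon$-close to $Q$. Let $\mathrm{OPT}$ be the least number of vertices of such a region. For $u,u'\in\partial\Pi$ let $[u,u']$ and $(u,u')$ be the closed and open intervals of $\partial\Pi$ traversed counterclockwise from $u$ to $u'$, where $[u,u]=\{u\}$, while for the open interval the way from $u$ to $u$ is one full turn, so that $(u,u)=\partial\Pi\setminus\{u\}$. The eyelet of $q_i$ is $\kappa_i=D_{r+\varepsilon}(q_i)\cap\Pi$.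 The points $x\in\kappa_i\cap\partial\Pi$ visible from $q_i$ (those for which the segment $\overline{q_ix}$ meets $\Pi$ only in $x$) form an interval $[v_i,w_i]$; its first point $v_i$ is called the spot of $\kappa_i$. For $u,u'\in\partial\Pi$ the segment $\overline{uu'}$ is good if it meets $\kappa_i$ for every $i$ with $v_i\in(u,u')$. The horizon $h_u$ of $u\in\partial\Pi$ is the farthest point of $\partial\Pi$ from $u$ in counterclockwise direction, within one full turn (the point $u$ itself counting as the end of the full turn), for which $\overline{uh_u}$ is good. For $s\in\partial\Pi$ define the polygon $P^s$ by its vertices $p_1,p_2,\dots$: put $p_1=s$; for $j\ge 1$, stop if $\overline{p_js}$ is good, and otherwise put $p_{j+1}=h_{p_j}$. Then for every $s\in\partial\Pi$ this construction is well defined and terminates, and $P^s$ has at most $\mathrm{OPT}+1$ vertices. -/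

import Mathlib

open scoped Pointwise

namespace OffsetDeconstruction

/-! The Euclidean plane is identified with `ℂ`, with its norm and its standard orientation. -/

/-- A bounded, closed polygonal region: its boundary is the union of finitely many line segments
(given by their pairs of endpoints) with pairwise disjoint interiors. It need be neither connected
nor convex, and degenerate regions such as a segment or a single point are allowed. -/
structure PolygonalRegion where
  carrier : Set ℂ
  edges : Finset (ℂ × ℂ)
  isClosed : IsClosed carrier
  isBounded : Bornology.IsBounded carrier
  frontier_eq : frontier carrier = ⋃ e ∈ edges, segment ℝ e.1 e.2
  disjoint_interiors : ∀ e ∈ edges, ∀ f ∈ edges, e ≠ f →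
    Disjoint (openSegment ℝ e.1 e.2) (openSegment ℝ f.1 f.2)

/-- The vertices of a polygonal region: the endpoints of its boundary segments. -/
noncomputable def PolygonalRegion.vertices (P : PolygonalRegion) : Finset ℂ :=
  P.edges.image Prod.fst ∪ P.edges.image Prod.snd

/-- The `r`-offset: the Minkowski sum with the closed disk of radius `r` around the origin. -/
def offset (X : Set ℂ) (r : ℝ) : Set ℂ := X + Metric.closedBall (0 : ℂ) r

/-- The `r`-inset (erosion). -/
def inset (X : Set ℂ) (r : ℝ) : Set ℂ := {x | Metric.closedBall x r ⊆ X}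

/-- `X` is `ε`-close to `Y`: their Hausdorff distance is at most `ε` (the extended distance is
used, so that the empty set is not close to a nonempty set). -/
def IsClose (ε : ℝ) (X Y : Set ℂ) : Prop := Metric.hausdorffEDist X Y ≤ ENNReal.ofReal ε

/-- The `r`-offset of `P` is `ε`-close to `Q`. -/
def IsSolution (Q : PolygonalRegion) (r ε : ℝ) (P : PolygonalRegion) : Prop :=
  IsClose ε Q.carrier (offset P.carrier r)

/-- `P` is vertex-minimal: it is a solution, and no solution has fewer vertices. -/
def IsMinimal (Q : PolygonalRegion) (r ε : ℝ) (P : PolygonalRegion) : Prop :=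
  IsSolution Q r ε P ∧
    ∀ P' : PolygonalRegion, IsSolution Q r ε P' → P.vertices.card ≤ P'.vertices.card

/-- The set `Π`: the `r`-inset of the `ε`-offset of `Q`. -/
def core (Q : PolygonalRegion) (r ε : ℝ) : Set ℂ := inset (offset Q.carrier ε) r

/-- The eyelet of a vertex `q` of `Q`. -/
def eyelet (Q : PolygonalRegion) (r ε : ℝ) (q : ℂ) : Set ℂ :=
  Metric.closedBall q (r + ε) ∩ core Q r ε

/-! Travelling counterclockwise along the boundary of a convex set `K` with an interior point `o`
is turning counterclockwise around `o`; the cyclic order of boundary points so obtained does not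
depend on the choice of `o` in the interior of `K`. -/

/-- The counterclockwise angle in `[0, 2π)` from the ray `ou` to the ray `ox`. -/
noncomputable def ccwAngle (o u x : ℂ) : ℝ :=
  toIcoMod Real.two_pi_pos 0 (Complex.arg ((x - o) / (u - o)))

/-- The angle in `(0, 2π]` swept when travelling counterclockwise from `u` until `u'` is reached
(again); the travel from `u` to `u` itself is a full turn. -/
noncomputable def ccwTurn (o u u' : ℂ) : ℝ :=
  open Classical in if u' = u then 2 * Real.pi else ccwAngle o u u'

/-- The closed boundary interval `[u, u']`, where `[u, u] = {u}`. -/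
def closedArc (K : Set ℂ) (o u u' : ℂ) : Set ℂ :=
  {x ∈ frontier K | ccwAngle o u x ≤ ccwAngle o u u'}

/-- The open boundary interval `(u, u')` of the points met strictly between `u` and `u'`;
as the travel from `u` to `u` is a full turn, `(u, u)` consists of all boundary points
other than `u`. -/
def openArc (K : Set ℂ) (o u u' : ℂ) : Set ℂ :=
  {x ∈ frontier K | x ≠ u ∧ ccwAngle o u x < ccwTurn o u u'}

/-- The portion of the eyelet of `q` on the boundary of `Π` which is visible from `q`, where `Π`
is an obstacle. -/
def visiblePart (Q : PolygonalRegion) (r ε : ℝ) (q : ℂ) : Set ℂ :=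
  {x ∈ eyelet Q r ε q ∩ frontier (core Q r ε) | segment ℝ q x ∩ core Q r ε = {x}}

/-- `v` is the spot of the eyelet of `q`: the visible portion is an interval `[v, w]`. -/
def IsSpot (Q : PolygonalRegion) (r ε : ℝ) (o q v : ℂ) : Prop :=
  v ∈ frontier (core Q r ε) ∧
    ∃ w ∈ frontier (core Q r ε), visiblePart Q r ε q = closedArc (core Q r ε) o v w

/-- The segment from `u` to `u'` is good: it meets every eyelet whose spot lies in `(u, u')`. -/
def IsGoodSegment (Q : PolygonalRegion) (r ε : ℝ) (o u u' : ℂ) : Prop :=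
  ∀ q ∈ Q.vertices, ∀ v, IsSpot Q r ε o q v → v ∈ openArc (core Q r ε) o u u' →
    (segment ℝ u u' ∩ eyelet Q r ε q).Nonempty

/-- `h` is the horizon of `u`: the maximal boundary point, in counterclockwise direction from `u`
(at most one full turn), for which the segment from `u` to `h` is good. -/
def IsHorizon (Q : PolygonalRegion) (r ε : ℝ) (o u h : ℂ) : Prop :=
  h ∈ frontier (core Q r ε) ∧ IsGoodSegment Q r ε o u h ∧
    ∀ x ∈ frontier (core Q r ε), IsGoodSegment Q r ε o u x → ccwTurn o u x ≤ ccwTurn o u h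

/-- `IsGreedyFrom Q r ε o s u l`: the greedy construction with start point `s`, continued from its
current vertex `u`, produces the finite list `l` of vertices (beginning with `u`). It stops at `u`
if the closing segment from `u` to `s` is good, and otherwise jumps to the horizon of `u`. -/
inductive IsGreedyFrom (Q : PolygonalRegion) (r ε : ℝ) (o s : ℂ) : ℂ → List ℂ → Prop
  | closing (u : ℂ) : IsGoodSegment Q r ε o u s → IsGreedyFrom Q r ε o s u [u]
  | jump (u h : ℂ) (l : List ℂ) : ¬ IsGoodSegment Q r ε o u s → IsHorizon Q r ε o u h →
      IsGreedyFrom Q r ε o s h l → IsGreedyFrom Q r ε o s u (u :: l)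

/-- `l` is the list of vertices `p₁ = s, p₂, …, p_m` of the greedy polygon `P^s`. -/
def IsGreedyPolygon (Q : PolygonalRegion) (r ε : ℝ) (o s : ℂ) (l : List ℂ) : Prop :=
  IsGreedyFrom Q r ε o s s l

end OffsetDeconstruction

/-! ### Polar parametrization of the boundary of a convex body -/

namespace OffsetDeconstruction

open Complex Set

/-! A solution `P` lies in the convex set Π and meets every eyelet. It also lies in the convex hull
of its vertices. Prolonging the ray from `s` through each vertex until it leaves Π gives at most OPT
boundary points whose convex hull, together with `s`, still meets every eyelet.

If the open arc cut off by a chord contains none of these points and not `s`, the chord is good.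
Indeed an eyelet with its spot on that arc is convex and also contains a point of the hull of the
complementary arc, so it crosses the chord (`IsConvexBody.segment_inter_chord_nonempty`, resting on
`IsConvexBody.diagonals_inter_nonempty`). Each horizon therefore reaches at least the next marked
point. It cannot reach or pass `s` unless the closing segment is good (`IsGoodSegment.shrink`). Each
jump uses up a marked point, and the start vertex accounts for the extra 1. Horizons exist by
compactness and are unique. -/

/-- `K` is a compact convex set with the interior point `o`. -/
structure IsConvexBody (K : Set ℂ) (o : ℂ) : Prop where
  convex : Convex ℝ K
  isCompact : IsCompact K
  mem_interior : o ∈ interior K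

/-- The distance from `o` to the boundary of `K` in the direction `θ`. -/
noncomputable def boundaryRadius (K : Set ℂ) (o : ℂ) (θ : ℝ) : ℝ :=
  (gauge ((o + ·) ⁻¹' K) (exp (θ * I)))⁻¹

/-- The boundary point of `K` seen from `o` in the direction `θ`. -/
noncomputable def boundaryPoint (K : Set ℂ) (o : ℂ) (θ : ℝ) : ℂ :=
  o + boundaryRadius K o θ * exp (θ * I)

namespace IsConvexBody

variable {K : Set ℂ} {o : ℂ} (hK : IsConvexBody K o)
include hK

lemma mem_nhds_translate : (o + ·) ⁻¹' K ∈ nhds (0 : ℂ) := by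
  have h : ContinuousAt (fun x : ℂ => o + x) 0 := by fun_prop
  exact h.preimage_mem_nhds (by simpa using mem_interior_iff_mem_nhds.1 hK.mem_interior)

lemma convex_translate : Convex ℝ ((o + ·) ⁻¹' K) :=
  hK.convex.translate_preimage_right o

lemma gauge_pos_of_ne {x : ℂ} (hx : x ≠ 0) : 0 < gauge ((o + ·) ⁻¹' K) x := by
  refine (gauge_pos (absorbent_nhds_zero hK.mem_nhds_translate) ?_).2 hx
  rw [NormedSpace.isVonNBounded_iff]
  exact ((Homeomorph.addLeft o).isCompact_preimage.2 hK.isCompact).isBounded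

lemma mem_frontier_iff {x : ℂ} : o + x ∈ frontier K ↔ gauge ((o + ·) ⁻¹' K) x = 1 := by
  rw [gauge_eq_one_iff_mem_frontier hK.convex_translate hK.mem_nhds_translate]
  have := (Homeomorph.addLeft o).preimage_frontier K
  exact Set.ext_iff.1 this x

lemma boundaryRadius_pos (θ : ℝ) : 0 < boundaryRadius K o θ :=
  inv_pos.2 (hK.gauge_pos_of_ne (exp_ne_zero _))

lemma boundaryPoint_mem (θ : ℝ) : boundaryPoint K o θ ∈ frontier K := by
  rw [boundaryPoint, hK.mem_frontier_iff, ← real_smul,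
    gauge_smul_of_nonneg (hK.boundaryRadius_pos θ).le, smul_eq_mul, boundaryRadius]
  exact inv_mul_cancel₀ (hK.gauge_pos_of_ne (exp_ne_zero _)).ne'

lemma continuous_boundaryPoint : Continuous (boundaryPoint K o) := by
  have hg : Continuous fun θ : ℝ => gauge ((o + ·) ⁻¹' K) (exp (θ * I)) :=
    (continuous_gauge hK.convex_translate hK.mem_nhds_translate).comp (by fun_prop)
  have hr : Continuous (boundaryRadius K o) :=
    hg.inv₀ fun θ => (hK.gauge_pos_of_ne (exp_ne_zero _)).ne'
  unfold boundaryPoint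
  fun_prop

omit hK in
lemma exp_add_two_pi (θ : ℝ) : exp ((θ + 2 * Real.pi : ℝ) * I) = exp (θ * I) := by
  push_cast
  rw [add_mul, exp_periodic]

omit hK in
lemma boundaryRadius_add_two_pi (θ : ℝ) :
    boundaryRadius K o (θ + 2 * Real.pi) = boundaryRadius K o θ := by
  simp only [boundaryRadius, exp_add_two_pi]

omit hK in
lemma boundaryPoint_add_two_pi (θ : ℝ) :
    boundaryPoint K o (θ + 2 * Real.pi) = boundaryPoint K o θ := by
  simp only [boundaryPoint, boundaryRadius_add_two_pi, exp_add_two_pi]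

omit hK in
lemma periodic_boundaryPoint : Function.Periodic (boundaryPoint K o) (2 * Real.pi) :=
  boundaryPoint_add_two_pi

/-- Every boundary point is attained in each half-open full turn of directions. -/
lemma exists_eq_boundaryPoint {x : ℂ} (hx : x ∈ frontier K) (a : ℝ) :
    ∃ θ ∈ Ico a (a + 2 * Real.pi), boundaryPoint K o θ = x := by
  have hg : gauge ((o + ·) ⁻¹' K) (x - o) = 1 := by
    rw [← hK.mem_frontier_iff]; simpa using hx
  have hpos : 0 < ‖x - o‖ := by
    rw [norm_pos_iff]
    intro h
    simp [h] at hg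
  have hpt : boundaryPoint K o (arg (x - o)) = x := by
    have h1 : ((‖x - o‖ : ℝ) : ℂ) * exp (arg (x - o) * I) = x - o := norm_mul_exp_arg_mul_I _
    have h2 : ‖x - o‖ * gauge ((o + ·) ⁻¹' K) (exp (arg (x - o) * I)) = 1 := by
      rw [← smul_eq_mul, ← gauge_smul_of_nonneg hpos.le, real_smul, h1, hg]
    have h3 : boundaryRadius K o (arg (x - o)) = ‖x - o‖ :=
      (eq_inv_of_mul_eq_one_left h2).symm
    rw [boundaryPoint, h3, h1]; ring
  obtain ⟨θ, hθ, h⟩ := periodic_boundaryPoint.exists_mem_Ico (f := boundaryPoint K o)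
    Real.two_pi_pos (arg (x - o)) a
  exact ⟨θ, hθ, by rw [← h, hpt]⟩

/-- The quotient of the two radius vectors is a positive real times `exp ((b - a) * I)`. This turns
boundary arcs into intervals of real parameters. -/
lemma ccwAngle_boundaryPoint {a b : ℝ} (hab : a ≤ b) (hb : b < a + 2 * Real.pi) :
    ccwAngle o (boundaryPoint K o a) (boundaryPoint K o b) = b - a := by
  have hra := hK.boundaryRadius_pos a
  have hrb := hK.boundaryRadius_pos b
  have h : (boundaryPoint K o b - o) / (boundaryPoint K o a - o) =
      ((boundaryRadius K o b / boundaryRadius K o a : ℝ) : ℂ) * exp ((b - a : ℝ) * I) := by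
    have : (boundaryRadius K o a : ℂ) ≠ 0 := by exact_mod_cast hra.ne'
    simp only [boundaryPoint, add_sub_cancel_left]
    push_cast
    rw [sub_mul, exp_sub]
    have := exp_ne_zero (a * I)
    field_simp
  rw [ccwAngle, h, arg_real_mul _ (div_pos hrb hra), arg_exp_mul_I, toIcoMod_toIocMod,
    toIcoMod_eq_self]
  constructor <;> linarith

lemma boundaryPoint_injOn (a : ℝ) :
    InjOn (boundaryPoint K o) (Ico a (a + 2 * Real.pi)) := by
  intro b hb c hc h
  have h1 := hK.ccwAngle_boundaryPoint hb.1 hb.2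
  rw [h, hK.ccwAngle_boundaryPoint hc.1 hc.2] at h1
  linarith

lemma ccwTurn_boundaryPoint {a b : ℝ} (hab : a < b) (hb : b ≤ a + 2 * Real.pi) :
    ccwTurn o (boundaryPoint K o a) (boundaryPoint K o b) = b - a := by
  rcases hb.eq_or_lt with rfl | hb
  · rw [ccwTurn, if_pos (boundaryPoint_add_two_pi a)]; ring
  · rw [ccwTurn, if_neg, hK.ccwAngle_boundaryPoint hab.le hb]
    intro h
    have := hK.boundaryPoint_injOn a ⟨hab.le, hb⟩
      ⟨le_rfl, by linarith [Real.two_pi_pos]⟩ h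
    exact hab.ne' this

lemma exists_eq_boundaryPoint_Ioc {x : ℂ} (hx : x ∈ frontier K) (a : ℝ) :
    ∃ θ ∈ Ioc a (a + 2 * Real.pi), boundaryPoint K o θ = x := by
  obtain ⟨θ, hθ, rfl⟩ := hK.exists_eq_boundaryPoint hx a
  rcases hθ.1.eq_or_lt with rfl | h
  · exact ⟨a + 2 * Real.pi, ⟨by linarith [Real.two_pi_pos], le_rfl⟩, boundaryPoint_add_two_pi a⟩
  · exact ⟨θ, ⟨h, hθ.2.le⟩, rfl⟩

lemma openArc_boundaryPoint {a b : ℝ} (hab : a < b) (hb : b ≤ a + 2 * Real.pi) :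
    openArc K o (boundaryPoint K o a) (boundaryPoint K o b) = boundaryPoint K o '' Ioo a b := by
  ext x
  simp only [openArc, mem_ofPred_eq, hK.ccwTurn_boundaryPoint hab hb]
  constructor
  · rintro ⟨hx, hne, hlt⟩
    obtain ⟨θ, hθ, rfl⟩ := hK.exists_eq_boundaryPoint hx a
    rw [hK.ccwAngle_boundaryPoint hθ.1 hθ.2] at hlt
    have : a ≠ θ := by rintro rfl; exact hne rfl
    exact ⟨θ, ⟨lt_of_le_of_ne hθ.1 this, by linarith⟩, rfl⟩
  · rintro ⟨θ, hθ, rfl⟩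
    have hθ' : θ < a + 2 * Real.pi := hθ.2.trans_le hb
    refine ⟨hK.boundaryPoint_mem θ, fun h => ?_, ?_⟩
    · exact hθ.1.ne' (hK.boundaryPoint_injOn a ⟨hθ.1.le, hθ'⟩
        ⟨le_rfl, by linarith [Real.two_pi_pos]⟩ h)
    · rw [hK.ccwAngle_boundaryPoint hθ.1.le hθ']
      linarith [hθ.2]

/-! ### Signed areas and crossing diagonals -/

/-- Twice the signed area of the triangle spanned by `o` and two boundary points. -/
noncomputable def _root_.OffsetDeconstruction.sectorArea (K : Set ℂ) (o : ℂ) (a b : ℝ) : ℝ :=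
  boundaryRadius K o a * boundaryRadius K o b * Real.sin (b - a)

omit hK in
lemma sectorArea_add_two_pi_right (a b : ℝ) :
    sectorArea K o a (b + 2 * Real.pi) = sectorArea K o a b := by
  rw [sectorArea, sectorArea, boundaryRadius_add_two_pi,
    show b + 2 * Real.pi - a = b - a + 2 * Real.pi by ring, Real.sin_add_two_pi]

omit hK in
lemma sectorArea_add_two_pi_left (a b : ℝ) :
    sectorArea K o (a + 2 * Real.pi) b = sectorArea K o a b := by
  rw [sectorArea, sectorArea, boundaryRadius_add_two_pi,
    show b - (a + 2 * Real.pi) = b - a - 2 * Real.pi by ring, Real.sin_sub_two_pi]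

omit hK in
lemma sectorArea_swap (a b : ℝ) : sectorArea K o a b = - sectorArea K o b a := by
  rw [sectorArea, sectorArea, ← neg_sub, Real.sin_neg]; ring

lemma sectorArea_nonneg {a b : ℝ} (hab : a ≤ b) (hb : b ≤ a + Real.pi) :
    0 ≤ sectorArea K o a b :=
  mul_nonneg (mul_pos (hK.boundaryRadius_pos a) (hK.boundaryRadius_pos b)).le
    (Real.sin_nonneg_of_nonneg_of_le_pi (by linarith) (by linarith))

lemma sectorArea_pos {a b : ℝ} (hab : a < b) (hb : b < a + Real.pi) :
    0 < sectorArea K o a b :=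
  mul_pos (mul_pos (hK.boundaryRadius_pos a) (hK.boundaryRadius_pos b))
    (Real.sin_pos_of_pos_of_lt_pi (by linarith) (by linarith))

omit hK in
lemma sin_sub_mul_exp (a b c : ℝ) :
    ((Real.sin (c - a) : ℝ) : ℂ) * exp (b * I) =
      (Real.sin (c - b) : ℝ) * exp (a * I) + (Real.sin (b - a) : ℝ) * exp (c * I) := by
  simp only [exp_mul_I, ← ofReal_cos, ← ofReal_sin, Real.sin_sub]
  apply Complex.ext <;> simp <;> ring

omit hK in
lemma sectorArea_mul_sub (a b c : ℝ) :
    (sectorArea K o a c : ℂ) * (boundaryPoint K o b - o) =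
      sectorArea K o b c * (boundaryPoint K o a - o) +
        sectorArea K o a b * (boundaryPoint K o c - o) := by
  have := sin_sub_mul_exp a b c
  simp only [boundaryPoint, sectorArea, add_sub_cancel_left, ofReal_mul]
  linear_combination (boundaryRadius K o a * boundaryRadius K o b * boundaryRadius K o c : ℂ) * this

/-- This is subadditivity of the gauge applied to the sine identity `sin_sub_mul_exp`, multiplied by
the three radii. -/
lemma sectorArea_le_add {a b c : ℝ} (hab : a ≤ b) (hbc : b ≤ c) (hc : c ≤ a + Real.pi) :
    sectorArea K o a c ≤ sectorArea K o a b + sectorArea K o b c := by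
  have h1 : 0 ≤ Real.sin (c - a) :=
    Real.sin_nonneg_of_nonneg_of_le_pi (by linarith) (by linarith)
  have h2 : 0 ≤ Real.sin (c - b) :=
    Real.sin_nonneg_of_nonneg_of_le_pi (by linarith) (by linarith)
  have h3 : 0 ≤ Real.sin (b - a) :=
    Real.sin_nonneg_of_nonneg_of_le_pi (by linarith) (by linarith)
  have key := gauge_add_le hK.convex_translate (absorbent_nhds_zero hK.mem_nhds_translate)
    (Real.sin (c - b) • exp (a * I)) (Real.sin (b - a) • exp (c * I))
  rw [gauge_smul_of_nonneg h2, gauge_smul_of_nonneg h3, real_smul, real_smul,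
    ← sin_sub_mul_exp, ← real_smul, gauge_smul_of_nonneg h1] at key
  have e (θ : ℝ) : gauge ((o + ·) ⁻¹' K) (exp (θ * I)) = (boundaryRadius K o θ)⁻¹ := by
    rw [boundaryRadius, inv_inv]
  simp only [e, smul_eq_mul] at key
  have ha := hK.boundaryRadius_pos a
  have hb := hK.boundaryRadius_pos b
  have hc' := hK.boundaryRadius_pos c
  have := mul_le_mul_of_nonneg_left key (mul_pos (mul_pos ha hb) hc').le
  simp only [sectorArea]
  field_simp at this
  nlinarith [this]

/-- Three boundary points in counterclockwise order span a triangle of nonnegative area. -/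
lemma triangleArea_nonneg {a b c : ℝ} (hab : a ≤ b) (hbc : b ≤ c) (hc : c ≤ a + 2 * Real.pi) :
    0 ≤ sectorArea K o a b + sectorArea K o b c - sectorArea K o a c := by
  have hca : sectorArea K o c (a + 2 * Real.pi) = - sectorArea K o a c := by
    rw [sectorArea_add_two_pi_right, sectorArea_swap]
  have hab' : sectorArea K o b (a + 2 * Real.pi) = - sectorArea K o a b := by
    rw [sectorArea_add_two_pi_right, sectorArea_swap]
  have hcb : sectorArea K o c (b + 2 * Real.pi) = - sectorArea K o b c := by
    rw [sectorArea_add_two_pi_right, sectorArea_swap]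
  have hab2 : sectorArea K o (a + 2 * Real.pi) (b + 2 * Real.pi) = sectorArea K o a b := by
    rw [sectorArea_add_two_pi_right, sectorArea_add_two_pi_left]
  -- If one of the three arcs between consecutive points is at least π, the points lie in a half
  -- turn starting at its end, and subadditivity applies. Otherwise the wanted quantity is a sum of
  -- three nonnegative sectors.
  by_cases h1 : c ≤ a + Real.pi
  · linarith [hK.sectorArea_le_add hab hbc h1]
  by_cases h2 : b ≤ a + Real.pi
  · by_cases h3 : c ≤ b + Real.pi
    · have := hK.sectorArea_nonneg hab h2
      have := hK.sectorArea_nonneg hbc h3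
      have := hK.sectorArea_nonneg hc (by linarith)
      linarith
    · have := hK.sectorArea_le_add hc (c := b + 2 * Real.pi) (by linarith) (by linarith)
      linarith
  · have := hK.sectorArea_le_add hbc hc (by linarith)
    linarith

omit hK in
lemma mem_segment_of_mul_eq {x y z : ℂ} {u v N : ℝ} (hu : 0 ≤ u) (hv : 0 ≤ v) (hN : 0 < N)
    (huv : u + v = N) (h : (N : ℂ) * z = u * x + v * y) : z ∈ segment ℝ x y := by
  refine ⟨u / N, v / N, by positivity, by positivity, by rw [← add_div, huv, div_self hN.ne'], ?_⟩
  have : (N : ℂ) ≠ 0 := by exact_mod_cast hN.ne'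
  simp only [real_smul, ofReal_div]
  field_simp
  exact h.symm

lemma mem_segment_of_area_eq_zero {a b c : ℝ} (hab : a < b) (hbc : b < c) (hc : c < a + Real.pi)
    (h : sectorArea K o a b + sectorArea K o b c - sectorArea K o a c = 0) :
    boundaryPoint K o b ∈ segment ℝ (boundaryPoint K o a) (boundaryPoint K o c) := by
  have hs : sectorArea K o b c + sectorArea K o a b = sectorArea K o a c := by linarith
  refine mem_segment_of_mul_eq (hK.sectorArea_nonneg hbc.le (by linarith))
    (hK.sectorArea_nonneg hab.le (by linarith)) (hK.sectorArea_pos (hab.trans hbc) hc) hs ?_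
  have hs' : (sectorArea K o b c : ℂ) + sectorArea K o a b = sectorArea K o a c := by
    exact_mod_cast hs
  linear_combination sectorArea_mul_sub (K := K) (o := o) a b c - o * hs'

/-- The diagonals of four boundary points in counterclockwise order meet. -/
lemma diagonals_inter_nonempty {a b c d : ℝ} (hab : a < b) (hbc : b < c) (hcd : c < d)
    (hd : d < a + 2 * Real.pi) :
    (segment ℝ (boundaryPoint K o b) (boundaryPoint K o d) ∩
      segment ℝ (boundaryPoint K o a) (boundaryPoint K o c)).Nonempty := by
  have habc := hK.triangleArea_nonneg hab.le hbc.le (by linarith)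
  have hacd := hK.triangleArea_nonneg (hab.trans hbc).le hcd.le hd.le
  have hbcd := hK.triangleArea_nonneg hbc.le hcd.le (by linarith)
  have habd := hK.triangleArea_nonneg hab.le (hbc.trans hcd).le hd.le
  -- The sum is twice the area of the quadrilateral. If it vanishes, all four triangles are flat.
  rcases (add_nonneg habc hacd).eq_or_lt with hN | hN
  · have hda : sectorArea K o d (a + 2 * Real.pi) = - sectorArea K o a d := by
      rw [sectorArea_add_two_pi_right, sectorArea_swap]
    have hca : sectorArea K o c (a + 2 * Real.pi) = - sectorArea K o a c := by
      rw [sectorArea_add_two_pi_right, sectorArea_swap]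
    have hdb : sectorArea K o d (b + 2 * Real.pi) = - sectorArea K o b d := by
      rw [sectorArea_add_two_pi_right, sectorArea_swap]
    have hab2 : sectorArea K o (a + 2 * Real.pi) (b + 2 * Real.pi) = sectorArea K o a b := by
      rw [sectorArea_add_two_pi_right, sectorArea_add_two_pi_left]
    have ha2 := boundaryPoint_add_two_pi (K := K) (o := o) a
    have hb2 := boundaryPoint_add_two_pi (K := K) (o := o) b
    by_cases h1 : d < a + Real.pi
    · exact ⟨_, left_mem_segment _ _ _,
        hK.mem_segment_of_area_eq_zero hab hbc (by linarith) (by linarith)⟩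
    by_cases h2 : a + Real.pi < b
    · exact ⟨_, hK.mem_segment_of_area_eq_zero hbc hcd (by linarith) (by linarith),
        right_mem_segment _ _ _⟩
    by_cases h3 : b + Real.pi < c
    · refine ⟨_, right_mem_segment _ _ _, ?_⟩
      rw [segment_symm, ← ha2]
      exact hK.mem_segment_of_area_eq_zero hcd hd (by linarith) (by linarith)
    by_cases h4 : c + Real.pi < d
    · refine ⟨_, ?_, left_mem_segment _ _ _⟩
      rw [segment_symm, ← ha2, ← hb2]
      exact hK.mem_segment_of_area_eq_zero hd (by linarith) (by linarith) (by linarith)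
    -- No gap exceeds π now, so four nonnegative sectors sum to zero. Each vanishes, which forces
    -- the first two gaps to equal π and leaves no room for `d`.
    exfalso
    push Not at h1 h2 h3 h4
    have e1 := hK.sectorArea_nonneg hab.le h2
    have e2 := hK.sectorArea_nonneg hbc.le h3
    have e3 := hK.sectorArea_nonneg hcd.le h4
    have e4 := hK.sectorArea_nonneg hd.le (by linarith)
    have g1 : b = a + Real.pi := by
      by_contra hne
      linarith [hK.sectorArea_pos hab (lt_of_le_of_ne h2 hne)]
    have g2 : c = b + Real.pi := by
      by_contra hne
      linarith [hK.sectorArea_pos hbc (lt_of_le_of_ne h3 hne)]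
    linarith
  · set N : ℝ := _ + _ with hNdef
    have hs : ∀ x y z : ℝ, (sectorArea K o x z : ℂ) * (boundaryPoint K o y - o) =
        sectorArea K o y z * (boundaryPoint K o x - o) +
        sectorArea K o x y * (boundaryPoint K o z - o) := fun x y z => sectorArea_mul_sub x y z
    -- The crossing point divides `bd` in the ratio of the areas of `abc` and `acd`; the areas of
    -- `bcd` and `abd` give its weights on `ac`.
    refine ⟨(((sectorArea K o a c + sectorArea K o c d - sectorArea K o a d : ℝ) : ℂ) / N *
        boundaryPoint K o b + ((sectorArea K o a b + sectorArea K o b c - sectorArea K o a c : ℝ) : ℂ)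
        / N * boundaryPoint K o d), ?_, ?_⟩
    · have hN' : (N : ℂ) ≠ 0 := by exact_mod_cast hN.ne'
      refine mem_segment_of_mul_eq hacd habc hN (by rw [hNdef]; ring) ?_
      field_simp
    · have hN' : (N : ℂ) ≠ 0 := by exact_mod_cast hN.ne'
      refine mem_segment_of_mul_eq hbcd habd hN (by rw [hNdef]; ring) ?_
      field_simp
      push_cast
      linear_combination hs a b c + hs a c d - hs a b d - hs b c d

end IsConvexBody
end OffsetDeconstruction

/-! ### Segments, rays and convex hulls -/

namespace OffsetDeconstruction

open Complex Set

/-- The points whose segment to `v` meets a convex set `T` form a convex set. -/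
lemma convex_setOf_segment_inter {T : Set ℂ} (hT : Convex ℝ T) (v : ℂ) :
    Convex ℝ {y | (segment ℝ v y ∩ T).Nonempty} := by
  rw [convex_iff_segment_subset]
  rintro x ⟨x', hx', hxT⟩ y ⟨y', hy', hyT⟩ z hz
  rw [segment_eq_image_lineMap] at hx' hy' hz
  obtain ⟨a, ⟨ha0, ha1⟩, rfl⟩ := hx'
  obtain ⟨b, ⟨hb0, hb1⟩, rfl⟩ := hy'
  obtain ⟨t, ⟨ht0, ht1⟩, rfl⟩ := hz
  rcases ha0.eq_or_lt with rfl | ha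
  · exact ⟨v, left_mem_segment _ _ _, by simpa using hxT⟩
  rcases hb0.eq_or_lt with rfl | hb
  · exact ⟨v, left_mem_segment _ _ _, by simpa using hyT⟩
  have hD : 0 < (1 - t) * b + t * a := by
    rcases ht0.eq_or_lt with rfl | ht
    · simpa using hb
    · have : 0 < t * a := by positivity
      have : 0 ≤ (1 - t) * b := mul_nonneg (by linarith) hb.le
      linarith
  have hw1 : 0 ≤ (1 - t) * b / ((1 - t) * b + t * a) :=
    div_nonneg (mul_nonneg (by linarith) hb.le) hD.le
  have hw2 : 0 ≤ t * a / ((1 - t) * b + t * a) := by positivity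
  have hw : (1 - t) * b / ((1 - t) * b + t * a) + t * a / ((1 - t) * b + t * a) = 1 := by
    rw [← add_div, div_self hD.ne']
  -- With hits at parameters `a` and `b`, the segment from `v` to `(1-t)x + ty` crosses the segment
  -- of the two hits at parameter `ab / ((1-t)b + ta)`.
  refine ⟨_, ?_, hT hxT hyT hw1 hw2 hw⟩
  rw [segment_eq_image_lineMap]
  refine ⟨a * b / ((1 - t) * b + t * a), ⟨by positivity, ?_⟩, ?_⟩
  · rw [div_le_one hD]
    nlinarith [mul_nonneg (sub_nonneg.2 ht1) (mul_nonneg hb.le (sub_nonneg.2 ha1)),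
      mul_nonneg ht0 (mul_nonneg ha.le (sub_nonneg.2 hb1))]
  · have hD' : (1 - t : ℂ) * b + t * a ≠ 0 := by exact_mod_cast hD.ne'
    simp only [AffineMap.lineMap_apply, vsub_eq_sub, vadd_eq_add, real_smul]
    push_cast
    obtain ⟨N, hN⟩ : ∃ N : ℂ, N = (1 - t : ℂ) * b + t * a := ⟨_, rfl⟩
    rw [← hN] at hD' ⊢
    field_simp
    rw [hN]
    ring

/-- A compact set is left along every ray starting in it. -/
lemma exists_add_mem_frontier {K : Set ℂ} (hK : IsCompact K) {p d : ℂ} (hp : p ∈ K) (hd : d ≠ 0) :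
    ∃ t : ℝ, 0 ≤ t ∧ p + t * d ∈ frontier K := by
  have hcont : Continuous fun t : ℝ => p + t * d := by fun_prop
  obtain ⟨R, hR⟩ := hK.isBounded.subset_closedBall p
  have hclosed : IsClosed (Ici (0 : ℝ) ∩ (fun t : ℝ => p + t * d) ⁻¹' K) :=
    isClosed_Ici.inter (hK.isClosed.preimage hcont)
  have hbdd : BddAbove (Ici (0 : ℝ) ∩ (fun t : ℝ => p + t * d) ⁻¹' K) := by
    refine ⟨R / ‖d‖, fun t ht => ?_⟩
    have := hR ht.2
    rw [Metric.mem_closedBall, dist_eq_norm, add_sub_cancel_left, norm_mul, norm_real] at this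
    rw [le_div_iff₀ (norm_pos_iff.2 hd)]
    exact (mul_le_mul_of_nonneg_right (le_abs_self t) (norm_nonneg d)).trans this
  have h0 : (0 : ℝ) ∈ Ici (0 : ℝ) ∩ (fun t : ℝ => p + t * d) ⁻¹' K :=
    ⟨le_refl (0 : ℝ), by simpa using hp⟩
  have hmem := hclosed.csSup_mem ⟨0, h0⟩ hbdd
  set T := sSup (Ici (0 : ℝ) ∩ (fun t : ℝ => p + t * d) ⁻¹' K)
  refine ⟨T, hmem.1, subset_closure hmem.2, fun hint => ?_⟩
  have hn : (fun t : ℝ => p + t * d) ⁻¹' K ∈ nhds T :=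
    hcont.continuousAt.preimage_mem_nhds (mem_interior_iff_mem_nhds.1 hint)
  obtain ⟨δ, hδ, hsub⟩ := Metric.mem_nhds_iff.1 hn
  have h1 : T + δ / 2 ∈ Ici (0 : ℝ) ∩ (fun t : ℝ => p + t * d) ⁻¹' K := by
    refine ⟨add_nonneg (mem_Ici.1 hmem.1) (half_pos hδ).le, hsub ?_⟩
    rw [Metric.mem_ball, Real.dist_eq, add_sub_cancel_left, abs_of_pos (by positivity)]
    linarith
  linarith [le_csSup hbdd h1]

/-- Prolong the ray from `s` through `p` until it leaves `K`. This moves vertices of a solution to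
the boundary while keeping them in a hull with `s`. -/
lemma exists_frontier_mem_segment {K : Set ℂ} (hK : IsCompact K) {s p : ℂ}
    (hs : s ∈ frontier K) (hp : p ∈ K) : ∃ x ∈ frontier K, p ∈ segment ℝ s x := by
  by_cases h : p = s
  · exact ⟨s, hs, by simp [h]⟩
  obtain ⟨t, ht, hx⟩ := exists_add_mem_frontier hK hp (sub_ne_zero.2 h)
  refine ⟨_, hx, ?_⟩
  rw [segment_eq_image_lineMap]
  refine ⟨1 / (1 + t), ⟨by positivity, by rw [div_le_one (by positivity)]; linarith⟩, ?_⟩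
  have : (1 + t : ℂ) ≠ 0 := by exact_mod_cast (by positivity : (1 + t : ℝ) ≠ 0)
  simp only [AffineMap.lineMap_apply, vsub_eq_sub, vadd_eq_add, real_smul]
  push_cast
  field_simp
  ring

lemma subset_convexHull_frontier {K : Set ℂ} (hK : IsCompact K) :
    K ⊆ convexHull ℝ (frontier K) := by
  intro p hp
  obtain ⟨t, -, hx⟩ := exists_add_mem_frontier hK hp one_ne_zero
  obtain ⟨y, hy, hpy⟩ := exists_frontier_mem_segment hK hx hp
  exact segment_subset_convexHull hx hy hpy

lemma PolygonalRegion.isCompact (P : PolygonalRegion) : IsCompact P.carrier :=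
  Metric.isCompact_of_isClosed_isBounded P.isClosed P.isBounded

lemma PolygonalRegion.vertices_subset_frontier (P : PolygonalRegion) :
    (P.vertices : Set ℂ) ⊆ frontier P.carrier := by
  intro x hx
  rw [P.frontier_eq]
  simp only [PolygonalRegion.vertices, Finset.coe_union, Finset.coe_image, mem_union, mem_image] at hx
  rcases hx with ⟨e, he, rfl⟩ | ⟨e, he, rfl⟩
  · exact mem_biUnion he (left_mem_segment _ _ _)
  · exact mem_biUnion he (right_mem_segment _ _ _)

lemma PolygonalRegion.vertices_subset (P : PolygonalRegion) : (P.vertices : Set ℂ) ⊆ P.carrier :=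
  P.vertices_subset_frontier.trans P.isClosed.frontier_subset

/-- A compact set lies in the hull of its frontier, and here the frontier is made of segments
between vertices. -/
lemma PolygonalRegion.subset_convexHull_vertices (P : PolygonalRegion) :
    P.carrier ⊆ convexHull ℝ (P.vertices : Set ℂ) := by
  refine (subset_convexHull_frontier P.isCompact).trans
    (convexHull_min ?_ (convex_convexHull ℝ _))
  rw [P.frontier_eq]
  refine iUnion₂_subset fun e he => segment_subset_convexHull ?_ ?_
  · exact Finset.mem_coe.2 (Finset.mem_union_left _ (Finset.mem_image_of_mem _ he))
  · exact Finset.mem_coe.2 (Finset.mem_union_right _ (Finset.mem_image_of_mem _ he))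

lemma mem_offset_iff {X : Set ℂ} {r : ℝ} {x : ℂ} : x ∈ offset X r ↔ ∃ y ∈ X, dist x y ≤ r := by
  constructor
  · rintro ⟨y, hy, z, hz, rfl⟩
    exact ⟨y, hy, by simpa [dist_eq_norm] using hz⟩
  · rintro ⟨y, hy, h⟩
    exact ⟨y, hy, x - y, by simpa [dist_eq_norm] using h, by ring⟩

lemma inset_eq_iInter {X : Set ℂ} {r : ℝ} :
    inset X r = ⋂ v ∈ Metric.closedBall (0 : ℂ) r, (· + v) ⁻¹' X := by
  ext x
  simp only [inset, mem_iInter, mem_preimage, mem_ofPred_eq]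
  constructor
  · intro h v hv
    exact h (by simpa [dist_eq_norm] using hv)
  · intro h y hy
    simpa using h (y - x) (by simpa [dist_eq_norm] using hy)

/-! ### Solutions, the core and the eyelets -/

section Core

variable {Q : PolygonalRegion} {r ε : ℝ} {o : ℂ}

lemma isConvexBody_core (hQ : Convex ℝ Q.carrier) (hr : 0 ≤ r)
    (ho : o ∈ interior (core Q r ε)) : IsConvexBody (core Q r ε) o := by
  have hcpt : IsCompact (offset Q.carrier ε) :=
    Q.isCompact.add (isCompact_closedBall (0 : ℂ) ε)
  have hconv : Convex ℝ (offset Q.carrier ε) := hQ.add (convex_closedBall (0 : ℂ) ε)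
  refine ⟨?_, ?_, ho⟩
  · rw [core, inset_eq_iInter]
    exact convex_iInter₂ fun v _ => hconv.translate_preimage_left v
  · refine hcpt.of_isClosed_subset ?_ fun x hx => hx (Metric.mem_closedBall_self hr)
    rw [core, inset_eq_iInter]
    exact isClosed_biInter fun v _ => hcpt.isClosed.preimage (by fun_prop)

lemma exists_dist_le_of_isClose {X Y : Set ℂ} (h : IsClose ε X Y) (hε : 0 ≤ ε) (hY : IsCompact Y)
    (hne : Y.Nonempty) {x : ℂ} (hx : x ∈ X) : ∃ y ∈ Y, dist x y ≤ ε := by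
  obtain ⟨y, hy, hxy⟩ := hY.exists_infEDist_eq_edist hne x
  refine ⟨y, hy, ?_⟩
  have := (Metric.infEDist_le_hausdorffEDist_of_mem hx).trans h
  rwa [hxy, edist_dist, ENNReal.ofReal_le_ofReal_iff hε] at this

lemma carrier_nonempty_of_mem_core (hr : 0 ≤ r) {x : ℂ} (hx : x ∈ core Q r ε) :
    Q.carrier.Nonempty := by
  obtain ⟨y, hy, -⟩ := mem_offset_iff.1 (hx (Metric.mem_closedBall_self hr))
  exact ⟨y, hy⟩

lemma IsSolution.subset_core {P : PolygonalRegion} (hP : IsSolution Q r ε P) (hε : 0 ≤ ε)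
    (hne : Q.carrier.Nonempty) : P.carrier ⊆ core Q r ε := by
  intro p hp x hx
  have hP' : IsClose ε (offset P.carrier r) Q.carrier := by
    rw [IsClose, Metric.hausdorffEDist_comm]; exact hP
  exact mem_offset_iff.2 (exists_dist_le_of_isClose hP' hε Q.isCompact hne
    (mem_offset_iff.2 ⟨p, hp, hx⟩))

/-- A solution meets every eyelet. -/
lemma IsSolution.exists_mem_eyelet {P : PolygonalRegion} (hP : IsSolution Q r ε P) (hε : 0 ≤ ε)
    {q : ℂ} (hq : q ∈ Q.vertices) : ∃ p ∈ P.carrier, p ∈ eyelet Q r ε q := by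
  have hq' := Q.vertices_subset hq
  have hne : (offset P.carrier r).Nonempty := by
    by_contra h
    rw [not_nonempty_iff_eq_empty] at h
    rw [IsSolution, IsClose, h, Metric.hausdorffEDist_empty ⟨q, hq'⟩] at hP
    exact absurd hP (by simp)
  obtain ⟨z, hz, hqz⟩ := exists_dist_le_of_isClose hP hε
    (P.isCompact.add (isCompact_closedBall (0 : ℂ) r)) hne hq'
  obtain ⟨p, hp, hzp⟩ := mem_offset_iff.1 hz
  refine ⟨p, hp, ?_, hP.subset_core hε ⟨q, hq'⟩ hp⟩
  rw [Metric.mem_closedBall, dist_comm]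
  linarith [dist_triangle q z p]

lemma convex_eyelet (hK : IsConvexBody (core Q r ε) o) (q : ℂ) : Convex ℝ (eyelet Q r ε q) :=
  (convex_closedBall q _).inter hK.convex

lemma isCompact_eyelet (hK : IsConvexBody (core Q r ε) o) (q : ℂ) :
    IsCompact (eyelet Q r ε q) :=
  (isCompact_closedBall q _).inter hK.isCompact

/-- The angle from `v` to itself is 0, so `v` belongs to its own arc. Membership in the eyelet is
all that the argument needs of a spot. -/
lemma IsSpot.mem_eyelet {q v : ℂ} (h : IsSpot Q r ε o q v) : v ∈ eyelet Q r ε q := by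
  obtain ⟨hv, w, hw, he⟩ := h
  have : v ∈ closedArc (core Q r ε) o v w := by
    refine ⟨hv, ?_⟩
    have h0 (z : ℂ) : 0 ≤ ccwAngle o v z := (toIcoMod_mem_Ico' Real.two_pi_pos _).1
    have : ccwAngle o v v = 0 := by
      rw [ccwAngle]
      have : arg ((v - o) / (v - o)) = 0 := by
        by_cases h : v - o = 0
        · simp [h]
        · rw [div_self h, arg_one]
      rw [this, toIcoMod_apply_left]
    rw [this]; exact h0 w
  rw [← he] at this
  exact this.1.1

end Core

/-! ### Good chords, horizons and the greedy walk -/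

section Greedy

variable {Q : PolygonalRegion} {r ε : ℝ} {o : ℂ}

local notation "γ" => boundaryPoint (core Q r ε) o

lemma isGoodSegment_iff (hK : IsConvexBody (core Q r ε) o) {a b : ℝ} (hab : a < b)
    (hb : b ≤ a + 2 * Real.pi) : IsGoodSegment Q r ε o (γ a) (γ b) ↔
      ∀ q ∈ Q.vertices, ∀ t ∈ Ioo a b, IsSpot Q r ε o q (γ t) →
        (segment ℝ (γ a) (γ b) ∩ eyelet Q r ε q).Nonempty := by
  rw [IsGoodSegment, hK.openArc_boundaryPoint hab hb]
  constructor
  · exact fun h q hq t ht hs => h q hq _ hs ⟨t, ht, rfl⟩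
  · rintro h q hq _ hs ⟨t, ht, rfl⟩
    exact h q hq t ht hs

/-- A chord separates the points of its open arc from the convex hull of the complementary arc. -/
lemma IsConvexBody.segment_inter_chord_nonempty {K : Set ℂ} (hK : IsConvexBody K o) {a b t : ℝ}
    (ht : t ∈ Ioo a b) {y : ℂ}
    (hy : y ∈ convexHull ℝ (boundaryPoint K o '' Icc b (a + 2 * Real.pi))) :
    (segment ℝ (boundaryPoint K o t) y ∩
      segment ℝ (boundaryPoint K o a) (boundaryPoint K o b)).Nonempty := by
  -- The condition on `y` is convex, so it suffices to check points of the complementary arc, where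
  -- diagonals cross.
  refine convexHull_min ?_ (convex_setOf_segment_inter (convex_segment _ _) _) hy
  rintro _ ⟨c, hc, rfl⟩
  rcases hc.1.eq_or_lt with rfl | hbc
  · exact ⟨_, right_mem_segment _ _ _, right_mem_segment _ _ _⟩
  rcases hc.2.eq_or_lt with rfl | hca
  · refine ⟨_, right_mem_segment _ _ _, ?_⟩
    rw [IsConvexBody.boundaryPoint_add_two_pi]
    exact left_mem_segment _ _ _
  exact hK.diagonals_inter_nonempty ht.1 ht.2 hbc hca

/-- A chord is good if every eyelet meets the convex hull of the complementary arc. -/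
lemma isGoodSegment_of_mem_convexHull (hK : IsConvexBody (core Q r ε) o) {a b : ℝ} (hab : a < b)
    (hb : b ≤ a + 2 * Real.pi)
    (h : ∀ q ∈ Q.vertices, ∀ t ∈ Ioo a b, IsSpot Q r ε o q (γ t) →
      (convexHull ℝ (γ '' Icc b (a + 2 * Real.pi)) ∩ eyelet Q r ε q).Nonempty) :
    IsGoodSegment Q r ε o (γ a) (γ b) := by
  rw [isGoodSegment_iff hK hab hb]
  intro q hq t ht hs
  obtain ⟨y, hy, hyq⟩ := h q hq t ht hs
  obtain ⟨z, hz, hz'⟩ := hK.segment_inter_chord_nonempty ht hy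
  exact ⟨z, hz', (convex_eyelet hK q).segment_subset hs.mem_eyelet hyq hz⟩

/-- Both ends of the longer chord lie on the arc complementary to the shorter one, so wherever the
longer chord meets an eyelet, it does so in the hull of that arc. -/
lemma IsGoodSegment.shrink (hK : IsConvexBody (core Q r ε) o) {a b c : ℝ} (hab : a < b)
    (hbc : b ≤ c) (hc : c ≤ a + 2 * Real.pi) (h : IsGoodSegment Q r ε o (γ a) (γ c)) :
    IsGoodSegment Q r ε o (γ a) (γ b) := by
  refine isGoodSegment_of_mem_convexHull hK hab (hbc.trans hc) fun q hq t ht hs => ?_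
  obtain ⟨y, hy, hyq⟩ := (isGoodSegment_iff hK (hab.trans_le hbc) hc).1 h q hq t
    ⟨ht.1, ht.2.trans_le hbc⟩ hs
  refine ⟨y, segment_subset_convexHull ?_ ?_ hy, hyq⟩
  · exact ⟨a + 2 * Real.pi, ⟨hbc.trans hc, le_rfl⟩, IsConvexBody.boundaryPoint_add_two_pi a⟩
  · exact ⟨c, ⟨hbc, hc⟩, rfl⟩

/-- The segments `xy` that meet a given compact set form a closed condition on `y`. -/
lemma isClosed_setOf_segment_inter_nonempty (x : ℂ) {T : Set ℂ} (hT : IsCompact T) :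
    IsClosed {y | (segment ℝ x y ∩ T).Nonempty} := by
  have hcl : IsClosed {p : ℂ × ℝ | AffineMap.lineMap x p.1 p.2 ∈ T} := by
    refine hT.isClosed.preimage ?_
    simp only [AffineMap.lineMap_apply]
    fun_prop
  have : {y | (segment ℝ x y ∩ T).Nonempty} =
      Prod.fst '' ({p : ℂ × ℝ | AffineMap.lineMap x p.1 p.2 ∈ T} ∩ univ ×ˢ Icc (0 : ℝ) 1) := by
    ext y
    simp only [segment_eq_image_lineMap]
    constructor
    · rintro ⟨_, ⟨t, ht, rfl⟩, hy⟩
      exact ⟨(y, t), ⟨hy, trivial, ht⟩, rfl⟩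
    · rintro ⟨⟨y, t⟩, ⟨hy, -, ht⟩, rfl⟩
      exact ⟨_, ⟨t, ht, rfl⟩, hy⟩
  rw [this]
  have key : {p : ℂ × ℝ | AffineMap.lineMap x p.1 p.2 ∈ T} ∩ univ ×ˢ Icc (0 : ℝ) 1 =
      (fun p : ℂ × Icc (0 : ℝ) 1 => (p.1, (p.2 : ℝ))) ''
        ((fun p : ℂ × Icc (0 : ℝ) 1 => (p.1, (p.2 : ℝ))) ⁻¹'
          {p : ℂ × ℝ | AffineMap.lineMap x p.1 p.2 ∈ T}) := by
    ext ⟨y, t⟩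
    constructor
    · rintro ⟨h, -, ht⟩
      exact ⟨(y, ⟨t, ht⟩), h, rfl⟩
    · rintro ⟨⟨y', t'⟩, h, hyt⟩
      obtain ⟨rfl, rfl⟩ := Prod.mk.inj hyt
      exact ⟨h, trivial, t'.2⟩
  rw [key, image_image]
  exact isClosedMap_fst_of_compactSpace _ (hcl.preimage (by fun_prop))

/-- If some segment from `u = γ a` is good, then `u` has a horizon. -/
lemma exists_isHorizon (hK : IsConvexBody (core Q r ε) o) {a c : ℝ} (hac : a < c)
    (hc : c ≤ a + 2 * Real.pi) (h : IsGoodSegment Q r ε o (γ a) (γ c)) :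
    ∃ b, c ≤ b ∧ b ≤ a + 2 * Real.pi ∧ IsHorizon Q r ε o (γ a) (γ b) := by
  set S : Set ℝ := {b | b ∈ Ioc a (a + 2 * Real.pi) ∧ IsGoodSegment Q r ε o (γ a) (γ b)} with hS
  have hne : S.Nonempty := ⟨c, ⟨hac, hc⟩, h⟩
  have hbdd : BddAbove S := ⟨a + 2 * Real.pi, fun b hb => hb.1.2⟩
  have hcb : c ≤ sSup S := le_csSup hbdd ⟨⟨hac, hc⟩, h⟩
  have hb : sSup S ≤ a + 2 * Real.pi := csSup_le hne fun b hb => hb.1.2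
  refine ⟨sSup S, hcb, hb, hK.boundaryPoint_mem _, ?_, ?_⟩
  · rw [isGoodSegment_iff hK (hac.trans_le hcb) hb]
    intro q hq t ht hs
    have hcl : IsClosed (γ ⁻¹' {y | (segment ℝ (γ a) y ∩ eyelet Q r ε q).Nonempty}) :=
      (isClosed_setOf_segment_inter_nonempty (γ a) (isCompact_eyelet hK q)).preimage
        hK.continuous_boundaryPoint
    -- Good parameters beyond `t` accumulate at the supremum. Their chords all meet the eyelet, and
    -- this is a closed condition.
    have hmem : sSup S ∈ closure (Ioi t ∩ S) :=
      isOpen_Ioi.inter_closure ⟨ht.2, csSup_mem_closure hne hbdd⟩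
    refine hcl.closure_subset_iff.2 ?_ hmem
    rintro b ⟨htb, hb, hgood⟩
    exact (isGoodSegment_iff hK hb.1 hb.2).1 hgood q hq t ⟨ht.1, htb⟩ hs
  · intro x hx hgood
    obtain ⟨θ, hθ, rfl⟩ := hK.exists_eq_boundaryPoint_Ioc hx a
    rw [hK.ccwTurn_boundaryPoint hθ.1 hθ.2, hK.ccwTurn_boundaryPoint (hac.trans_le hcb) hb]
    linarith [le_csSup hbdd (show θ ∈ S from ⟨hθ, hgood⟩)]

lemma IsHorizon.unique (hK : IsConvexBody (core Q r ε) o) {u x y : ℂ}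
    (hu : u ∈ frontier (core Q r ε)) (hx : IsHorizon Q r ε o u x) (hy : IsHorizon Q r ε o u y) :
    x = y := by
  obtain ⟨a, -, rfl⟩ := hK.exists_eq_boundaryPoint hu 0
  obtain ⟨b, hb, rfl⟩ := hK.exists_eq_boundaryPoint_Ioc hx.1 a
  obtain ⟨c, hc, rfl⟩ := hK.exists_eq_boundaryPoint_Ioc hy.1 a
  have h1 := hx.2.2 _ hy.1 hy.2.1
  have h2 := hy.2.2 _ hx.1 hx.2.1
  rw [hK.ccwTurn_boundaryPoint hb.1 hb.2, hK.ccwTurn_boundaryPoint hc.1 hc.2] at h1 h2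
  rw [show b = c by linarith]

lemma IsGreedyFrom.unique (hK : IsConvexBody (core Q r ε) o) {s u : ℂ} {l l' : List ℂ}
    (hu : u ∈ frontier (core Q r ε)) (h : IsGreedyFrom Q r ε o s u l)
    (h' : IsGreedyFrom Q r ε o s u l') : l = l' := by
  induction h generalizing l' with
  | closing u hg =>
    cases h' with
    | closing => rfl
    | jump _ _ _ hn => exact absurd hg hn
  | jump u x l hn hx _ ih =>
    cases h' with
    | closing _ hg => exact absurd hg hn
    | jump _ y l' _ hy hl' =>
      obtain rfl := hx.unique hK hu hy
      rw [ih hx.1 hl']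

/-- If all eyelets meet the convex hull of the start point and of further boundary points with
directions in `Θ`, then the greedy construction has at most one vertex more than it still has
directions of `Θ` ahead of it. -/
lemma exists_isGreedyFrom (hK : IsConvexBody (core Q r ε) o) (s : ℝ) (Θ : Finset ℝ)
    (hΘ : ∀ θ ∈ Θ, θ ∈ Ico s (s + 2 * Real.pi))
    (hmeet : ∀ q ∈ Q.vertices,
      (convexHull ℝ (γ '' insert s (Θ : Set ℝ)) ∩ eyelet Q r ε q).Nonempty)
    (a : ℝ) (ha : a ∈ Ico s (s + 2 * Real.pi)) :
    ∃ l, IsGreedyFrom Q r ε o (γ s) (γ a) l ∧ l.length ≤ (Θ.filter (a < ·)).card + 1 := by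
  -- All marked points, and `s` itself, lie on the complementary arc; those at or before `a` are
  -- shifted by a full turn.
  have hgood : ∀ a b : ℝ, s ≤ a → a < b → b ≤ s + 2 * Real.pi → (∀ θ ∈ Θ, a < θ → b ≤ θ) →
      IsGoodSegment Q r ε o (γ a) (γ b) := by
    intro a b hsa hab hb hfree
    refine isGoodSegment_of_mem_convexHull hK hab (by linarith) fun q hq _ _ _ => ?_
    refine (hmeet q hq).mono (inter_subset_inter_left _ (convexHull_mono ?_))
    have hle : ∀ θ, θ ∈ Ico s (s + 2 * Real.pi) → (a < θ → b ≤ θ) →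
        γ θ ∈ γ '' Icc b (a + 2 * Real.pi) := by
      intro θ hθ hf
      rcases le_or_gt θ a with h | h
      · exact ⟨θ + 2 * Real.pi, ⟨by linarith [hθ.1], by linarith⟩, IsConvexBody.boundaryPoint_add_two_pi θ⟩
      · exact ⟨θ, ⟨hf h, by linarith [hθ.2]⟩, rfl⟩
    rintro _ ⟨θ, rfl | hθ, rfl⟩
    · exact hle θ ⟨le_rfl, by linarith [Real.two_pi_pos]⟩ fun h => absurd hsa (not_le.2 h)
    · exact hle θ (hΘ θ hθ) (hfree θ hθ)
  induction hn : (Θ.filter (a < ·)).card using Nat.strong_induction_on generalizing a with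
  | _ n ih =>
    by_cases hclose : IsGoodSegment Q r ε o (γ a) (γ s)
    · exact ⟨_, .closing _ hclose, by simp⟩
    have hs2 : γ (s + 2 * Real.pi) = γ s := IsConvexBody.boundaryPoint_add_two_pi s
    have hne : (Θ.filter (a < ·)).Nonempty := by
      rw [Finset.nonempty_iff_ne_empty]
      intro hempty
      refine hclose ?_
      rw [← hs2]
      refine hgood a _ ha.1 ha.2 le_rfl fun θ hθ haθ => ?_
      exact absurd (Finset.mem_filter.2 ⟨hθ, haθ⟩) (by rw [hempty]; simp)
    set c := (Θ.filter (a < ·)).min' hne with hcdef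
    have hc := Finset.mem_filter.1 ((Θ.filter (a < ·)).min'_mem hne)
    rw [← hcdef] at hc
    have hcs := hΘ c hc.1
    have hac : IsGoodSegment Q r ε o (γ a) (γ c) :=
      hgood a c ha.1 hc.2 hcs.2.le fun θ hθ haθ =>
        Finset.min'_le _ _ (Finset.mem_filter.2 ⟨hθ, haθ⟩)
    obtain ⟨b, hcb, hb, hhor⟩ := exists_isHorizon hK hc.2 (by linarith [hcs.2, ha.1]) hac
    -- A horizon at or beyond a full turn from `s` would make the closing segment good by shrinking.
    have hbs : b < s + 2 * Real.pi := by
      by_contra hle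
      rw [not_lt] at hle
      refine hclose ?_
      rw [← hs2]
      exact IsGoodSegment.shrink hK ha.2 hle hb hhor.2.1
    -- The direction `c` was ahead of `a` but is not strictly ahead of `b`.
    have hlt : (Θ.filter (b < ·)).card < n := by
      rw [← hn]
      refine Finset.card_lt_card (Finset.ssubset_iff_subset_ne.2 ⟨fun θ hθ => ?_, fun h => ?_⟩)
      · rw [Finset.mem_filter] at hθ ⊢
        exact ⟨hθ.1, by linarith [hθ.2, hc.2]⟩
      · have : c ∈ Θ.filter (b < ·) := by
          rw [h]; exact Finset.mem_filter.2 hc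
        exact absurd (Finset.mem_filter.1 this).2 (not_lt.2 hcb)
    obtain ⟨l, hl, hlen⟩ := ih _ hlt b ⟨by linarith [ha.1, hc.2], hbs⟩ rfl
    exact ⟨_, .jump _ _ _ hclose hhor hl, by simp only [List.length_cons]; omega⟩

end Greedy

end OffsetDeconstruction

theorem mainTheorem9 (Q : OffsetDeconstruction.PolygonalRegion) (hQ : Convex ℝ Q.carrier)
    (r ε : ℝ) (hε : 0 < ε) (hr : ε < r)
    (P : OffsetDeconstruction.PolygonalRegion)
    (hP : OffsetDeconstruction.IsMinimal Q r ε P)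
    (o : ℂ) (ho : o ∈ interior (OffsetDeconstruction.core Q r ε))
    (s : ℂ) (hs : s ∈ frontier (OffsetDeconstruction.core Q r ε)) :
    (∃! l : List ℂ, OffsetDeconstruction.IsGreedyPolygon Q r ε o s l) ∧
      ∀ l : List ℂ, OffsetDeconstruction.IsGreedyPolygon Q r ε o s l →
        l.length ≤ P.vertices.card + 1 := by
  open OffsetDeconstruction in
  have hr0 : 0 ≤ r := (hε.trans hr).le
  have hK := isConvexBody_core hQ hr0 ho
  have hsub := hP.1.subset_core hε.le (carrier_nonempty_of_mem_core hr0 (interior_subset ho))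
  obtain ⟨σ, -, rfl⟩ := hK.exists_eq_boundaryPoint hs 0
  -- The value `σ` for points that are not vertices is a dummy that makes the choice function total.
  have hdir : ∀ p : ℂ, ∃ θ ∈ Set.Ico σ (σ + 2 * Real.pi), p ∈ P.vertices →
      p ∈ segment ℝ (boundaryPoint (core Q r ε) o σ) (boundaryPoint (core Q r ε) o θ) := by
    intro p
    by_cases hp : p ∈ P.vertices
    · obtain ⟨x, hx, hpx⟩ := exists_frontier_mem_segment hK.isCompact hs
        (hsub (P.vertices_subset hp))
      obtain ⟨θ, hθ, rfl⟩ := hK.exists_eq_boundaryPoint hx σ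
      exact ⟨θ, hθ, fun _ => hpx⟩
    · exact ⟨σ, ⟨le_rfl, by linarith [Real.two_pi_pos]⟩, fun h => absurd h hp⟩
  choose f hf hfseg using hdir
  obtain ⟨l, hl, hlen⟩ := exists_isGreedyFrom hK σ (P.vertices.image f)
    (by simp only [Finset.mem_image]; rintro _ ⟨p, -, rfl⟩; exact hf p)
    (by
      intro q hq
      obtain ⟨p, hp, hpq⟩ := hP.1.exists_mem_eyelet hε.le hq
      refine ⟨p, convexHull_min ?_ (convex_convexHull ℝ _) (P.subset_convexHull_vertices hp), hpq⟩
      intro v hv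
      exact segment_subset_convexHull (Set.mem_image_of_mem _ (Set.mem_insert _ _))
        (Set.mem_image_of_mem _ (Set.mem_insert_of_mem _
          (Finset.mem_coe.2 (Finset.mem_image_of_mem f hv))))
        (hfseg v hv))
    σ ⟨le_rfl, by linarith [Real.two_pi_pos]⟩
  have huniq : ∀ l', IsGreedyPolygon Q r ε o (boundaryPoint (core Q r ε) o σ) l' → l' = l :=
    fun l' hl' => IsGreedyFrom.unique hK hs hl' hl
  refine ⟨⟨l, hl, huniq⟩, fun l' hl' => ?_⟩
  rw [huniq l' hl']
  refine hlen.trans (Nat.add_le_add_right ?_ 1)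
  -- Several vertices may share a direction, and the direction `σ` is not counted; both only lower
  -- the bound.
  exact (Finset.card_filter_le _ _).trans Finset.card_image_le
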